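/- Let $X$ be a non-compact locally compact Cantor set, that is, a non-compact locally compact metrizable space without isolated points and with a countable basis of compact open sets. All measures are Borel measures on $X$ that are full (every non-empty open set has positive measure) and non-atomic (for the measures considered here, equivalently: every point has measure zero). A measure $\mu$ is called good if for all compact open sets $U,V\subset X$ with $\mu(U)<\mu(V)$ there is a compact open set $W\subset V$ with $\mu(W)=\mu(U)$. An infinite measure $\mu$ ($\mu(X)=\infty$) is called non-defective if $\mu(\mathfrak M_\mu)=0$, where $\mathfrak M_\mu$ is the set of all $x\in X$ such that $\mu(U)=\infty$ for every compact open set $U\ni x$. Measures $\mu,\nu$ on $X$ are called homeomorphic if there is a homeomorphism $h\colon X\to X$ with $\mu(E)=\nu(h(E))$ for all Borel sets $E\subset X$, and weakly homeomorphic if there are a homeomorphism $h\colon X\to X$ and a real constant $C>0$ with $\mu(E)=C\,\nu(h(E))$ for all Borel sets $E\subset X$. Then the set of classes of homeomorphic good probability measures on $X$ has the cardinality of the continuum. Likewise, the set of classes of weakly homeomorphic good infinite non-defective measures on $X$ has the cardinality of the continuum. -/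

import Mathlib

open scoped ENNReal NNReal Cardinal

namespace LocallyCompactCantor

/-- A non-compact locally compact Cantor set: a non-compact, locally compact, metrizable space
without isolated points that has a countable basis of compact open sets. -/
structure IsNoncompactCantor (X : Type*) [TopologicalSpace X] : Prop where
  noncompact : NoncompactSpace X
  locallyCompact : LocallyCompactSpace X
  metrizable : TopologicalSpace.MetrizableSpace X
  no_isolated_points : ∀ x : X, ¬ IsOpen ({x} : Set X)
  exists_basis : ∃ B : Set (Set X), B.Countable ∧ TopologicalSpace.IsTopologicalBasis B ∧
    ∀ U ∈ B, IsCompact U ∧ IsOpen U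

section Measures

variable {X Y Z : Type*} [TopologicalSpace X] [MeasurableSpace X] [TopologicalSpace Y]
  [MeasurableSpace Y] [TopologicalSpace Z] [MeasurableSpace Z]

/-- A full non-atomic measure: non-empty open sets have positive measure and points have
measure zero. -/
structure IsFullNonatomic (μ : MeasureTheory.Measure X) : Prop where
  full : ∀ U : Set X, IsOpen U → U.Nonempty → 0 < μ U
  nonatomic : ∀ x : X, μ {x} = 0

/-- The defective set: the points all of whose compact open neighbourhoods have infinite
measure. -/
def defectiveSet (μ : MeasureTheory.Measure X) : Set X :=
  {x | ∀ U : Set X, IsCompact U → IsOpen U → x ∈ U → μ U = ∞}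

/-- Every compact open set `V` is good for `μ`: each value `μ U < μ V` on a compact open `U`
is attained on a compact open subset of `V`. -/
def IsGood (μ : MeasureTheory.Measure X) : Prop :=
  ∀ V : Set X, IsCompact V → IsOpen V →
    ∀ U : Set X, IsCompact U → IsOpen U → μ U < μ V →
      ∃ W : Set X, IsCompact W ∧ IsOpen W ∧ W ⊆ V ∧ μ W = μ U

/-- `μ` and `ν` are homeomorphic: `μ E = ν (h E)` on Borel sets for some homeomorphism `h`. -/
def Homeomorphic (μ : MeasureTheory.Measure X) (ν : MeasureTheory.Measure Y) : Prop :=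
  ∃ h : X ≃ₜ Y, ∀ E : Set X, MeasurableSet E → μ E = ν (h '' E)

/-- `μ` and `ν` are weakly homeomorphic: `μ E = C * ν (h E)` on Borel sets for some
homeomorphism `h` and some real constant `C > 0`. -/
def WeaklyHomeomorphic (μ : MeasureTheory.Measure X) (ν : MeasureTheory.Measure Y) : Prop :=
  ∃ h : X ≃ₜ Y, ∃ C : ℝ≥0, 0 < C ∧
    ∀ E : Set X, MeasurableSet E → μ E = (C : ℝ≥0∞) * ν (h '' E)

theorem Homeomorphic.refl (μ : MeasureTheory.Measure X) : Homeomorphic μ μ :=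
  ⟨Homeomorph.refl X, fun E _ => by simp⟩

theorem Homeomorphic.symm [BorelSpace X] [BorelSpace Y] {μ : MeasureTheory.Measure X}
    {ν : MeasureTheory.Measure Y} (H : Homeomorphic μ ν) : Homeomorphic ν μ := by
  obtain ⟨h, hh⟩ := H
  refine ⟨h.symm, fun E hE => ?_⟩
  rw [hh _ (h.symm.measurableEmbedding.measurableSet_image.2 hE), Set.image_image]
  simp

theorem Homeomorphic.trans [BorelSpace X] [BorelSpace Y] {μ : MeasureTheory.Measure X}
    {ν : MeasureTheory.Measure Y} {ρ : MeasureTheory.Measure Z}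
    (H : Homeomorphic μ ν) (K : Homeomorphic ν ρ) : Homeomorphic μ ρ := by
  obtain ⟨h, hh⟩ := H
  obtain ⟨k, hk⟩ := K
  refine ⟨h.trans k, fun E hE => ?_⟩
  rw [hh E hE, hk _ (h.measurableEmbedding.measurableSet_image.2 hE), Set.image_image]
  rfl

theorem WeaklyHomeomorphic.refl (μ : MeasureTheory.Measure X) : WeaklyHomeomorphic μ μ :=
  ⟨Homeomorph.refl X, 1, one_pos, fun E _ => by simp⟩

theorem WeaklyHomeomorphic.symm [BorelSpace X] [BorelSpace Y] {μ : MeasureTheory.Measure X}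
    {ν : MeasureTheory.Measure Y} (H : WeaklyHomeomorphic μ ν) : WeaklyHomeomorphic ν μ := by
  obtain ⟨h, C, hC, hh⟩ := H
  refine ⟨h.symm, C⁻¹, inv_pos.2 hC, fun E hE => ?_⟩
  rw [hh _ (h.symm.measurableEmbedding.measurableSet_image.2 hE), Set.image_image, ← mul_assoc,
    ← ENNReal.coe_mul, inv_mul_cancel₀ hC.ne']
  simp

theorem WeaklyHomeomorphic.trans [BorelSpace X] [BorelSpace Y] {μ : MeasureTheory.Measure X}
    {ν : MeasureTheory.Measure Y} {ρ : MeasureTheory.Measure Z}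
    (H : WeaklyHomeomorphic μ ν) (K : WeaklyHomeomorphic ν ρ) : WeaklyHomeomorphic μ ρ := by
  obtain ⟨h, C, hC, hh⟩ := H
  obtain ⟨k, D, hD, hk⟩ := K
  refine ⟨h.trans k, C * D, mul_pos hC hD, fun E hE => ?_⟩
  rw [hh E hE, hk _ (h.measurableEmbedding.measurableSet_image.2 hE), Set.image_image,
    ENNReal.coe_mul, mul_assoc]
  rfl

end Measures

/-- The good full non-atomic probability measures on `X`. -/
def GoodProbabilityMeasure (X : Type*) [TopologicalSpace X] [MeasurableSpace X] : Type _ :=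
  {μ : MeasureTheory.Measure X // IsFullNonatomic μ ∧ μ Set.univ = 1 ∧ IsGood μ}

/-- The good full non-atomic infinite measures on `X` that are non-defective, i.e. whose
defective set has measure zero. -/
def GoodInfiniteMeasure (X : Type*) [TopologicalSpace X] [MeasurableSpace X] : Type _ :=
  {μ : MeasureTheory.Measure X //
    IsFullNonatomic μ ∧ μ Set.univ = ∞ ∧ μ (defectiveSet μ) = 0 ∧ IsGood μ}

/-- The relation of being homeomorphic on good probability measures. -/
def homeomorphicSetoid (X : Type*) [TopologicalSpace X] [MeasurableSpace X] [BorelSpace X] :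
    Setoid (GoodProbabilityMeasure X) where
  r μ ν := Homeomorphic μ.1 ν.1
  iseqv := ⟨fun μ => Homeomorphic.refl μ.1, fun H => H.symm, fun H K => H.trans K⟩

/-- The relation of being weakly homeomorphic on good infinite non-defective measures. -/
def weaklyHomeomorphicSetoid (X : Type*) [TopologicalSpace X] [MeasurableSpace X]
    [BorelSpace X] : Setoid (GoodInfiniteMeasure X) where
  r μ ν := WeaklyHomeomorphic μ.1 ν.1
  iseqv := ⟨fun μ => WeaklyHomeomorphic.refl μ.1, fun H => H.symm, fun H K => H.trans K⟩

end LocallyCompactCantor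

/-! Upper bound: there are only countably many compact open sets, and a non-defective measure is
determined by its values on them (`ext_of_compactOpen`), so there are at most continuum many
measures. A probability measure has empty defective set.

Lower bound: for a countable dense subgroup `G` of the reals and `I = [0, 1)` or `[0, ∞)`, a good
measure is built whose values on compact open sets are exactly `G ∩ I`
(`IsNoncompactCantor.exists_isGood`). A lexicographic order on the space yields a countable chain of
compact open initial segments, densely ordered and without a largest element, whose differences form
a basis. By Cantor's theorem the chain can be indexed by `G ∩ I`. A map `s` with `s t ∈ C g ↔ t < g`
then pushes Lebesgue measure on `I` to a measure giving `C g` the value `g`.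

Which primes divide every value inside the value set is unchanged by homeomorphism and by scaling.
Taking for `G` the fractions whose denominators have prime factors only `2` or in `T` recovers every
set `T` of odd primes, hence continuum many classes. -/

namespace LocallyCompactCantor

open Set TopologicalSpace MeasureTheory

/-! ### Lexicographic order and a chain of compact open initial segments -/

section Topology

variable {X : Type*}

/-- The first `n` memberships of a point in the sets `b i`, read as a binary number in which
the digit `0` stands for membership. -/
noncomputable def word (b : ℕ → Set X) : ℕ → X → ℕ
  | 0, _ => 0
  | n + 1, x => 2 * word b n x + (b n)ᶜ.indicator 1 x

theorem indicator_one_le_one (s : Set X) (x : X) : s.indicator (1 : X → ℕ) x ≤ 1 := by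
  by_cases h : x ∈ s <;> simp [h]

theorem word_lt_of_le {b : ℕ → Set X} {x y : X} {n m : ℕ} (hnm : n ≤ m)
    (h : word b n x < word b n y) : word b m x < word b m y := by
  induction m, hnm using Nat.le_induction with
  | base => exact h
  | succ m _ ih =>
    have := indicator_one_le_one (b m)ᶜ x
    simp only [word]
    omega

theorem word_le_of_le {b : ℕ → Set X} {x y : X} {n m : ℕ} (hnm : n ≤ m)
    (h : word b m x ≤ word b m y) : word b n x ≤ word b n y := by
  by_contra h'
  exact absurd (word_lt_of_le hnm (not_le.1 h')) (not_lt.2 h)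

/-- Digit `k` separates the points: equal words of length `n` would have equal truncations to
lengths `k` and `k + 1`. -/
theorem word_ne {b : ℕ → Set X} {x y : X} {k n : ℕ} (hx : x ∈ b k) (hy : y ∉ b k) (hkn : k < n) :
    word b n x ≠ word b n y := by
  intro h
  have h1 := word_le_of_le (Nat.succ_le_of_lt hkn) h.le
  have h2 := word_le_of_le (Nat.succ_le_of_lt hkn) h.ge
  simp only [word, indicator_of_notMem (show x ∉ (b k)ᶜ by simpa using hx),
    indicator_of_mem (show y ∈ (b k)ᶜ from hy), Pi.one_apply] at h1 h2
  omega

/-- All digits of `y` are `1`, so its word is the largest of its length. This is what makes proper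
initial segments compact. -/
theorem word_le_of_forall_notMem {b : ℕ → Set X} {y : X} {n : ℕ} (hy : ∀ i < n, y ∉ b i) (x : X) :
    word b n x ≤ word b n y := by
  induction n with
  | zero => simp [word]
  | succ n ih =>
    have := indicator_one_le_one (b n)ᶜ x
    have h2 := ih fun i hi => hy i (hi.trans n.lt_succ_self)
    simp only [word, indicator_of_mem (show y ∈ (b n)ᶜ from hy n n.lt_succ_self), Pi.one_apply]
    omega

/-- A set is initial if it is a lower set for the lexicographic order given by `word`. -/
def IsInitial (b : ℕ → Set X) (U : Set X) : Prop :=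
  ∀ x ∈ U, ∀ y, (∀ n, word b n y ≤ word b n x) → y ∈ U

/-- The lexicographic comparison is total: a strict inequality between prefixes persists in all
longer prefixes, so two points cannot each exceed the other. -/
theorem IsInitial.subset_or_subset {b : ℕ → Set X} {U V : Set X} (hU : IsInitial b U)
    (hV : IsInitial b V) : U ⊆ V ∨ V ⊆ U := by
  by_contra! h
  obtain ⟨x, hxU, hxV⟩ := not_subset.1 h.1
  obtain ⟨y, hyV, hyU⟩ := not_subset.1 h.2
  refine hyU (hU x hxU y fun n => ?_)
  by_contra hn
  refine hxV (hV y hyV x fun m => ?_)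
  by_contra hm
  rcases le_total n m with hnm | hnm
  · exact absurd (word_lt_of_le hnm (not_le.1 hn)) (not_lt.2 (not_le.1 hm).le)
  · exact absurd (word_lt_of_le hnm (not_le.1 hm)) (not_lt.2 (not_le.1 hn).le)

theorem isInitial_word_lt (b : ℕ → Set X) (n k : ℕ) : IsInitial b {y | word b n y < k} :=
  fun _ hx _ hy => (hy n).trans_lt hx

variable [TopologicalSpace X]

theorem IsNoncompactCantor.exists_seq_basis (hX : IsNoncompactCantor X) :
    ∃ b : ℕ → Set X, IsTopologicalBasis (range b) ∧ ∀ n, IsCompact (b n) ∧ IsOpen (b n) := by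
  obtain ⟨B, hBc, hB, hBco⟩ := hX.exists_basis
  have hne : B.Nonempty := by
    by_contra h
    have : IsEmpty X := ⟨fun x => by
      obtain ⟨U, hU, -⟩ := hB.exists_subset_of_mem_open (mem_univ x) isOpen_univ
      exact h ⟨U, hU⟩⟩
    have := hX.noncompact
    exact not_compactSpace_iff.2 this inferInstance
  obtain ⟨b, rfl⟩ := hBc.exists_eq_range hne
  exact ⟨b, hB, fun n => hBco _ (mem_range_self n)⟩

theorem countable_compactOpen {B : Set (Set X)} (hB : IsTopologicalBasis B) (hBc : B.Countable) :
    {U : Set X | IsCompact U ∧ IsOpen U}.Countable := by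
  refine ((countable_ofPred_finite_subset hBc).image sUnion).mono fun U hU => ?_
  obtain ⟨s, hs, hUs⟩ := eq_finite_iUnion_of_isTopologicalBasis_of_isCompact_open
    ((↑) : B → Set X) (by simpa using hB) U hU.1 hU.2
  refine ⟨(↑) '' s, ⟨hs.image _, by simp⟩, ?_⟩
  rw [hUs, sUnion_image]

theorem continuous_word {b : ℕ → Set X} (hb : ∀ n, IsClopen (b n)) (n : ℕ) :
    Continuous (word b n) := by
  induction n with
  | zero => exact continuous_const
  | succ n ih =>
    refine (continuous_const.mul ih).add (continuous_const.indicator ?_)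
    simp [(hb n).compl.frontier_eq]

theorem isClopen_word_lt {b : ℕ → Set X} (hb : ∀ n, IsClopen (b n)) (n k : ℕ) :
    IsClopen {y | word b n y < k} :=
  (isClopen_discrete (Iio k)).preimage (continuous_word hb n)

/-- A point outside `b 0, …, b (n - 1)` has the maximal word, strictly above that of `x`, so the
segment is a closed subset of a finite union of compact sets. -/
theorem isCompact_word_lt {b : ℕ → Set X} (hb : ∀ n, IsClopen (b n)) (hbc : ∀ n, IsCompact (b n))
    {x : X} {i n k : ℕ} (hx : x ∈ b i) (hin : i < n) (hk : k ≤ word b n x + 1) :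
    IsCompact {y | word b n y < k} := by
  refine ((finite_Iio n).isCompact_biUnion fun j _ => hbc j).of_isClosed_subset
    (isClopen_word_lt hb n k).isClosed fun y hy => ?_
  by_contra hy'
  have hy' : ∀ j < n, y ∉ b j := by simpa using hy'
  have h1 := word_le_of_forall_notMem hy' x
  have h2 := word_ne hx (hy' i hin) hin
  simp only [mem_ofPred_eq] at hy
  omega

theorem IsNoncompactCantor.exists_chain (hX : IsNoncompactCantor X) :
    ∃ 𝒞 : Set (Set X), 𝒞.Countable ∧ IsChain (· ≤ ·) 𝒞 ∧ ∅ ∈ 𝒞 ∧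
      (∀ C ∈ 𝒞, IsCompact C ∧ IsOpen C) ∧
      (∀ C ∈ 𝒞, ∀ D ∈ 𝒞, C ⊂ D → ∃ E ∈ 𝒞, C ⊂ E ∧ E ⊂ D) ∧
      (∀ C ∈ 𝒞, ∃ D ∈ 𝒞, C ⊂ D) ∧
      ∀ U, IsOpen U → ∀ x ∈ U, ∃ C ∈ 𝒞, ∃ D ∈ 𝒞, x ∈ D \ C ∧ D \ C ⊆ U := by
  have := hX.metrizable
  have := hX.noncompact
  obtain ⟨b, hb, hbco⟩ := hX.exists_seq_basis
  have hbcl : ∀ n, IsClopen (b n) := fun n => ⟨(hbco n).1.isClosed, (hbco n).2⟩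
  have hbase : ∀ U, IsOpen U → ∀ x ∈ U, ∃ k, x ∈ b k ∧ b k ⊆ U := fun U hU x hx => by
    obtain ⟨_, ⟨k, rfl⟩, h⟩ := hb.exists_subset_of_mem_open hx hU
    exact ⟨k, h⟩
  have hseg : ∀ x k, x ∈ b k → ∀ n, k < n → ∀ l ≤ word b n x + 1,
      IsCompact {y | word b n y < l} ∧ IsOpen {y | word b n y < l} ∧
        IsInitial b {y | word b n y < l} := fun x k hx n hn l hl =>
    ⟨isCompact_word_lt hbcl (fun n => (hbco n).1) hx hn hl, (isClopen_word_lt hbcl n l).isOpen,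
      isInitial_word_lt b n l⟩
  have hchain : IsChain (· ≤ ·) {U | IsCompact U ∧ IsOpen U ∧ IsInitial b U} :=
    fun U hU V hV _ => hU.2.2.subset_or_subset hV.2.2
  refine ⟨{U | IsCompact U ∧ IsOpen U ∧ IsInitial b U},
    (countable_compactOpen hb (countable_range b)).mono fun U hU => And.intro hU.1 hU.2.1, hchain,
    ⟨isCompact_empty, isOpen_empty, fun x hx => absurd hx (notMem_empty x)⟩,
    fun C hC => And.intro hC.1 hC.2.1, ?_, ?_, ?_⟩
  · rintro C ⟨hCc, hCo, hCi⟩ D ⟨hDc, hDo, hDi⟩ hCD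
    obtain ⟨x, hxD, hxC⟩ := exists_of_ssubset hCD
    have hopen : IsOpen (D \ C) := hDo.sdiff hCc.isClosed
    obtain ⟨y, ⟨hyD, hyC⟩, hyx⟩ : ∃ y ∈ D \ C, y ≠ x := by
      by_contra! h
      refine hX.no_isolated_points x ?_
      rwa [← show D \ C = {x} from Subset.antisymm (fun y hy => h y hy)
        (singleton_subset_iff.2 ⟨hxD, hxC⟩)]
    obtain ⟨k, hxk, hk⟩ := hbase {y}ᶜ isOpen_compl_singleton x (by simpa using hyx.symm)
    have hne : word b (k + 1) x ≠ word b (k + 1) y :=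
      word_ne hxk (fun h => hk h rfl) k.lt_succ_self
    -- Cutting `D` just below the word of `v` separates `u` from `v`; adjoining `C` keeps the set
    -- between `C` and `D`.
    have key : ∀ u v, u ∈ D \ C → v ∈ D \ C → word b (k + 1) u < word b (k + 1) v →
        ∃ E ∈ {U | IsCompact U ∧ IsOpen U ∧ IsInitial b U}, C ⊂ E ∧ E ⊂ D := by
      rintro u v ⟨huD, huC⟩ ⟨hvD, hvC⟩ huv
      have hW := isClopen_word_lt hbcl (k + 1) (word b (k + 1) v)
      refine ⟨C ∪ (D ∩ {z | word b (k + 1) z < word b (k + 1) v}),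
        ⟨hCc.union (hDc.inter_right hW.isClosed), hCo.union (hDo.inter hW.isOpen), ?_⟩, ?_, ?_⟩
      · rintro z (hz | ⟨hz, hz'⟩) w hw
        · exact Or.inl (hCi z hz w hw)
        · exact Or.inr ⟨hDi z hz w hw, isInitial_word_lt b _ _ z hz' w hw⟩
      · exact (ssubset_iff_of_subset subset_union_left).2 ⟨u, Or.inr ⟨huD, huv⟩, huC⟩
      · refine (ssubset_iff_of_subset (union_subset hCD.subset inter_subset_left)).2
          ⟨v, hvD, ?_⟩
        rintro (h | ⟨-, h⟩)
        · exact hvC h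
        · exact (mem_ofPred_eq ▸ h : _ < _).false
    rcases lt_or_gt_of_ne hne with h | h
    · exact key x y ⟨hxD, hxC⟩ ⟨hyD, hyC⟩ h
    · exact key y x ⟨hyD, hyC⟩ ⟨hxD, hxC⟩ h
  · rintro C ⟨hCc, hCo, hCi⟩
    obtain ⟨x, hx⟩ : ∃ x, x ∉ C := by
      by_contra! h
      exact noncompact_univ X (eq_univ_of_forall h ▸ hCc)
    obtain ⟨k, hxk, -⟩ := hbase univ isOpen_univ x (mem_univ x)
    have hD := hseg x k hxk (k + 1) k.lt_succ_self _ le_rfl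
    have hxD : x ∈ {y | word b (k + 1) y < word b (k + 1) x + 1} := Nat.lt_succ_self _
    refine ⟨_, hD, ?_⟩
    rcases hCi.subset_or_subset hD.2.2 with h | h
    · exact (ssubset_iff_of_subset h).2 ⟨x, hxD, hx⟩
    · exact absurd (h hxD) hx
  · intro U hU x hx
    obtain ⟨k, hxk, hk⟩ := hbase U hU x hx
    -- The difference of these two segments is the set of points sharing the first `k + 1` digits of
    -- `x`; digit `k` puts them all in `b k`.
    refine ⟨_, hseg x k hxk (k + 1) k.lt_succ_self (word b (k + 1) x) (Nat.le_succ _),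
      _, hseg x k hxk (k + 1) k.lt_succ_self _ le_rfl, ⟨Nat.lt_succ_self _, by simp⟩,
      fun y hy => hk ?_⟩
    by_contra hyk
    refine word_ne hxk hyk (Nat.lt_add_one k) ?_
    simp only [mem_sdiff, mem_ofPred_eq] at hy
    omega

end Topology

/-! ### Indexing the chain by a countable dense set of reals -/

section IndexedChain

variable {X : Type*} [TopologicalSpace X]

/-- A family of compact open sets, strictly increasing on the index set `Γ`, starting with the
empty set, whose differences form a basis of the topology. -/
structure IsIndexedChain (Γ : Set ℝ) (C : ℝ → Set X) : Prop where
  zero : C 0 = ∅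
  isCompact : ∀ g ∈ Γ, IsCompact (C g)
  isOpen : ∀ g ∈ Γ, IsOpen (C g)
  strictMonoOn : StrictMonoOn C Γ
  exists_mem_diff : ∀ U, IsOpen U → ∀ x ∈ U, ∃ g ∈ Γ, ∃ h ∈ Γ, x ∈ C h \ C g ∧ C h \ C g ⊆ U

/-- An interval in `[0, ∞)` that contains `0` and has no largest element. -/
structure IsValueInterval (I : Set ℝ) : Prop where
  ordConnected : I.OrdConnected
  zero_mem : 0 ∈ I
  nonneg : ∀ a ∈ I, 0 ≤ a
  exists_gt : ∀ a ∈ I, ∃ b ∈ I, a < b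

theorem isValueInterval_Ico : IsValueInterval (Ico 0 1) :=
  ⟨ordConnected_Ico, by simp, fun _ h => h.1, fun a ha => by
    obtain ⟨b, hab, hb⟩ := exists_between ha.2
    exact ⟨b, ⟨ha.1.trans hab.le, hb⟩, hab⟩⟩

theorem isValueInterval_Ici : IsValueInterval (Ici 0) :=
  ⟨ordConnected_Ici, by simp, fun _ h => h,
    fun a ha => ⟨a + 1, mem_Ici.2 (add_nonneg ha zero_le_one), lt_add_one a⟩⟩

theorem IsValueInterval.exists_between {I G : Set ℝ} (hI : IsValueInterval I) (hG : Dense G)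
    {a b : ℝ} (ha : a ∈ I) (hb : b ∈ I) (hab : a < b) : ∃ c ∈ G ∩ I, a < c ∧ c < b := by
  obtain ⟨c, hc, hac, hcb⟩ := hG.exists_between hab
  exact ⟨c, ⟨hc, hI.ordConnected.out ha hb ⟨hac.le, hcb.le⟩⟩, hac, hcb⟩

theorem IsNoncompactCantor.exists_isIndexedChain (hX : IsNoncompactCantor X) {G I : Set ℝ}
    (hGc : G.Countable) (hG : Dense G) (hI : IsValueInterval I) (hG0 : 0 ∈ G) :
    ∃ C : ℝ → Set X, IsIndexedChain (G ∩ I) C := by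
  classical
  obtain ⟨𝒞, hcount, hchain, hempty, hco, hdense, hmax, hbase⟩ := hX.exists_chain
  have hchain' : IsChain (· ≤ ·) (𝒞 \ {∅}) := hchain.mono sdiff_subset
  -- The empty set is the least element of the chain. Without it no endpoint is left, as Cantor's
  -- theorem requires; it returns as the value at `0`.
  let : LinearOrder ↥(𝒞 \ {∅}) := hchain'.linearOrder
  have hpos : ∀ D ∈ 𝒞, D ≠ ∅ → (∅ : Set X) ⊂ D := fun D _ hD =>
    empty_ssubset.2 (nonempty_iff_ne_empty.2 hD)
  have : Countable ↥(𝒞 \ {∅}) := (hcount.mono sdiff_subset).to_subtype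
  have : Nonempty ↥(𝒞 \ {∅}) := by
    obtain ⟨D, hD, h⟩ := hmax ∅ hempty
    exact ⟨D, hD, fun h' => h.ne h'.symm⟩
  have : NoMinOrder ↥(𝒞 \ {∅}) := ⟨fun ⟨D, hD, hD'⟩ => by
    obtain ⟨E, hE, h1, h2⟩ := hdense ∅ hempty D hD (hpos D hD hD')
    exact ⟨⟨E, hE, fun h' => h1.ne h'.symm⟩, h2⟩⟩
  have : NoMaxOrder ↥(𝒞 \ {∅}) := ⟨fun ⟨D, hD, hD'⟩ => by
    obtain ⟨E, hE, h1⟩ := hmax D hD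
    exact ⟨⟨E, hE, fun h' => (empty_subset D).not_ssubset (h' ▸ h1)⟩, h1⟩⟩
  have : DenselyOrdered ↥(𝒞 \ {∅}) := ⟨fun ⟨D, hD, hD'⟩ ⟨D₂, hD₂, hD₂'⟩ h => by
    obtain ⟨E, hE, h1, h2⟩ := hdense D hD D₂ hD₂ h
    exact ⟨⟨E, hE, fun h' => (empty_subset D).not_ssubset (h' ▸ h1)⟩, h1, h2⟩⟩
  let Γ : Set ℝ := (G ∩ I) ∩ Ioi 0
  have hbetween : ∀ a ∈ I, ∀ b ∈ I, a < b → ∃ c ∈ Γ, a < c ∧ c < b := fun a ha b hb hab => by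
    obtain ⟨c, hc, hac, hcb⟩ := hI.exists_between hG ha hb hab
    exact ⟨c, ⟨hc, (hI.nonneg a ha).trans_lt hac⟩, hac, hcb⟩
  have : Countable Γ := (hGc.mono fun _ h => h.1.1).to_subtype
  have : Nonempty Γ := by
    obtain ⟨b, hb, h⟩ := hI.exists_gt 0 hI.zero_mem
    obtain ⟨c, hc, -⟩ := hbetween 0 hI.zero_mem b hb h
    exact ⟨c, hc⟩
  have : NoMinOrder Γ := ⟨fun ⟨a, ha⟩ => by
    obtain ⟨c, hc, -, h⟩ := hbetween 0 hI.zero_mem a ha.1.2 ha.2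
    exact ⟨⟨c, hc⟩, h⟩⟩
  have : NoMaxOrder Γ := ⟨fun ⟨a, ha⟩ => by
    obtain ⟨b, hb, h⟩ := hI.exists_gt a ha.1.2
    obtain ⟨c, hc, h, -⟩ := hbetween a ha.1.2 b hb h
    exact ⟨⟨c, hc⟩, h⟩⟩
  have : DenselyOrdered Γ := ⟨fun ⟨a, ha⟩ ⟨b, hb⟩ h => by
    obtain ⟨c, hc, h1, h2⟩ := hbetween a ha.1.2 b hb.1.2 h
    exact ⟨⟨c, hc⟩, h1, h2⟩⟩
  obtain ⟨e⟩ := Order.iso_of_countable_dense Γ ↥(𝒞 \ {∅})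
  have hC : ∀ g (hg : g ∈ Γ), (if h : g ∈ Γ then (e ⟨g, h⟩ : Set X) else ∅) = e ⟨g, hg⟩ :=
    fun g hg => dif_pos hg
  have hmem : ∀ g ∈ G ∩ I, (if h : g ∈ Γ then (e ⟨g, h⟩ : Set X) else ∅) ∈ 𝒞 := fun g hg => by
    split_ifs with h
    · exact (e ⟨g, h⟩).2.1
    · exact hempty
  have hsurj : ∀ D ∈ 𝒞, ∃ g ∈ G ∩ I, (if h : g ∈ Γ then (e ⟨g, h⟩ : Set X) else ∅) = D :=
    fun D hD => by
      by_cases h : D = ∅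
      · exact ⟨0, ⟨hG0, hI.zero_mem⟩, by rw [dif_neg (fun h => lt_irrefl (0 : ℝ) h.2), h]⟩
      · refine ⟨e.symm ⟨D, hD, h⟩, (e.symm ⟨D, hD, h⟩).2.1, ?_⟩
        rw [hC _ (e.symm ⟨D, hD, h⟩).2]
        simp
  refine ⟨fun g => if h : g ∈ Γ then (e ⟨g, h⟩ : Set X) else ∅, dif_neg fun h => lt_irrefl (0 : ℝ) h.2,
    fun g hg => (hco _ (hmem g hg)).1, fun g hg => (hco _ (hmem g hg)).2, ?_, ?_⟩
  · intro g hg h hh hgh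
    have hh' : h ∈ Γ := ⟨hh, (hI.nonneg g hg.2).trans_lt hgh⟩
    simp only [dif_pos hh']
    split_ifs with hg'
    · exact e.strictMono (show (⟨g, hg'⟩ : Γ) < ⟨h, hh'⟩ from hgh)
    · exact hpos _ (e ⟨h, hh'⟩).2.1 (e ⟨h, hh'⟩).2.2
  · intro U hU x hx
    obtain ⟨D, hD, E, hE, h1, h2⟩ := hbase U hU x hx
    obtain ⟨g, hg, rfl⟩ := hsurj D hD
    obtain ⟨h, hh, rfl⟩ := hsurj E hE
    exact ⟨g, hg, h, hh, h1, h2⟩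

end IndexedChain

/-! ### Lebesgue measure transported along the chain -/

section ChainMeasure

variable {X : Type*} [TopologicalSpace X] {G : AddSubgroup ℝ} {I : Set ℝ} {C : ℝ → Set X}

theorem IsIndexedChain.mem_of_le {Γ : Set ℝ} (hC : IsIndexedChain Γ C) {g h : ℝ} (hg : g ∈ Γ)
    (hh : h ∈ Γ) (hgh : g ≤ h) {x : X} (hx : x ∈ C g) : x ∈ C h :=
  (hC.strictMonoOn.monotoneOn hg hh hgh : C g ⊆ C h) hx

theorem IsIndexedChain.exists_subset {Γ : Set ℝ} (hC : IsIndexedChain Γ C) (h0 : 0 ∈ Γ)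
    {U : Set X} (hU : IsCompact U) : ∃ g ∈ Γ, U ⊆ C g := by
  have : Nonempty Γ := ⟨0, h0⟩
  obtain ⟨g, hg⟩ := hU.elim_directed_cover (fun g : Γ => C g) (fun g => hC.isOpen g g.2)
    (fun x _ => by
      obtain ⟨_, -, h, hh, hx, -⟩ := hC.exists_mem_diff univ isOpen_univ x (mem_univ x)
      exact mem_iUnion.2 ⟨⟨h, hh⟩, hx.1⟩)
    (hC.strictMonoOn.monotoneOn.monotone.directed_le)
  exact ⟨g, g.2, hg⟩

/-- Points of the interval lift to points of the space, compatibly with the chain. -/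
theorem IsIndexedChain.exists_section [T2Space X] (hI : IsValueInterval I)
    (hG : Dense (G : Set ℝ)) (hC : IsIndexedChain (G ∩ I) C) :
    ∃ s : ℝ → X, ∀ t ∈ I, ∀ g ∈ (G : Set ℝ) ∩ I, s t ∈ C g ↔ t < g := by
  have key : ∀ t ∈ I, ∃ x, ∀ g ∈ (G : Set ℝ) ∩ I, x ∈ C g ↔ t < g := by
    intro t ht
    let J := {p : ℝ × ℝ // (p.1 ∈ (G : Set ℝ) ∩ I ∧ p.2 ∈ (G : Set ℝ) ∩ I) ∧ p.1 ≤ t ∧ t < p.2}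
    obtain ⟨b, hb, htb⟩ := hI.exists_gt t ht
    obtain ⟨c, hc, htc, -⟩ := hI.exists_between hG ht hb htb
    have h0 : (0 : ℝ) ∈ (G : Set ℝ) ∩ I := ⟨G.zero_mem, hI.zero_mem⟩
    have : Nonempty J := ⟨⟨(0, c), ⟨h0, hc⟩, hI.nonneg t ht, htc⟩⟩
    have hmax : ∀ a b : ℝ, a ∈ (G : Set ℝ) ∩ I → b ∈ (G : Set ℝ) ∩ I →
        max a b ∈ (G : Set ℝ) ∩ I ∧ min a b ∈ (G : Set ℝ) ∩ I := fun a b ha hb => by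
      rcases le_total a b with h | h <;> simp only [h, max_eq_left, max_eq_right, min_eq_left,
        min_eq_right, ha, hb, and_self]
    -- The sets `C h \ C g` with `g ≤ t < h` are compact, non-empty and directed downwards; any
    -- common point can serve as the image of `t`.
    obtain ⟨x, hx⟩ := IsCompact.nonempty_iInter_of_directed_nonempty_isCompact_isClosed
      (fun p : J => C p.1.2 \ C p.1.1)
      (fun p q => ⟨⟨(max p.1.1 q.1.1, min p.1.2 q.1.2),
          ⟨(hmax _ _ p.2.1.1 q.2.1.1).1, (hmax _ _ p.2.1.2 q.2.1.2).2⟩,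
          max_le p.2.2.1 q.2.2.1, lt_min p.2.2.2 q.2.2.2⟩,
        fun x hx => ⟨hC.mem_of_le (hmax _ _ p.2.1.2 q.2.1.2).2 p.2.1.2 (min_le_left _ _) hx.1,
          fun h => hx.2 (hC.mem_of_le p.2.1.1 (hmax _ _ p.2.1.1 q.2.1.1).1 (le_max_left _ _) h)⟩,
        fun x hx => ⟨hC.mem_of_le (hmax _ _ p.2.1.2 q.2.1.2).2 q.2.1.2 (min_le_right _ _) hx.1,
          fun h => hx.2
            (hC.mem_of_le q.2.1.1 (hmax _ _ p.2.1.1 q.2.1.1).1 (le_max_right _ _) h)⟩⟩)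
      (fun p => by
        obtain ⟨x, h1, h2⟩ := exists_of_ssubset
          (hC.strictMonoOn p.2.1.1 p.2.1.2 (p.2.2.1.trans_lt p.2.2.2))
        exact ⟨x, h1, h2⟩)
      (fun p => (hC.isCompact _ p.2.1.2).diff (hC.isOpen _ p.2.1.1))
      (fun p => ((hC.isCompact _ p.2.1.2).diff (hC.isOpen _ p.2.1.1)).isClosed)
    rw [mem_iInter] at hx
    refine ⟨x, fun g hg => ⟨fun hxg => ?_, fun htg => (hx ⟨(0, g), ⟨h0, hg⟩, hI.nonneg t ht, htg⟩).1⟩⟩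
    by_contra htg
    exact (hx ⟨(g, c), ⟨hg, hc⟩, not_lt.1 htg, htc⟩).2 hxg
  have : Nonempty X := ⟨(key 0 hI.zero_mem).choose⟩
  choose! s hs using key
  exact ⟨s, hs⟩

theorem IsIndexedChain.exists_measurable_section [T2Space X] [MeasurableSpace X] [BorelSpace X]
    (hI : IsValueInterval I) (hG : Dense (G : Set ℝ)) (hGc : (G : Set ℝ).Countable)
    (hC : IsIndexedChain (G ∩ I) C) :
    ∃ s : ℝ → X, Measurable s ∧ ∀ t ∈ I, ∀ g ∈ (G : Set ℝ) ∩ I, s t ∈ C g ↔ t < g := by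
  classical
  obtain ⟨s, hs⟩ := hC.exists_section hI hG
  have hIm : MeasurableSet I := hI.ordConnected.measurableSet
  refine ⟨I.piecewise s fun _ => s 0, measurable_of_isOpen fun U hU => ?_,
    fun t ht g hg => by rw [piecewise_eq_of_mem _ _ _ ht]; exact hs t ht g hg⟩
  -- Within `I`, the preimage of a basic set `C h \ C g` is `[g, h)`, and only countably many pairs
  -- occur.
  have hpre : I ∩ s ⁻¹' U = I ∩ ⋃ p ∈ {p : ℝ × ℝ | (p.1 ∈ (G : Set ℝ) ∩ I ∧
      p.2 ∈ (G : Set ℝ) ∩ I) ∧ C p.2 \ C p.1 ⊆ U}, Ico p.1 p.2 := by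
    ext t
    refine and_congr_right fun ht => ⟨fun htU => mem_iUnion₂.2 ?_, fun ht' => ?_⟩
    · obtain ⟨g, hg, h, hh, hx, hsub⟩ := hC.exists_mem_diff U hU (s t) htU
      exact ⟨(g, h), ⟨⟨hg, hh⟩, hsub⟩, not_lt.1 fun h' => hx.2 ((hs t ht g hg).2 h'),
        (hs t ht h hh).1 hx.1⟩
    · obtain ⟨⟨g, h⟩, ⟨⟨hg, hh⟩, hsub⟩, h1, h2⟩ := mem_iUnion₂.1 ht'
      exact hsub ⟨(hs t ht h hh).2 h2, fun h' => absurd ((hs t ht g hg).1 h') (not_lt.2 h1)⟩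
  rw [piecewise_preimage, Set.ite, inter_comm, hpre]
  refine (hIm.inter (MeasurableSet.biUnion ?_ fun _ _ => measurableSet_Ico)).union
    ((measurable_const hU.measurableSet).diff hIm)
  exact (hGc.prod hGc).mono fun p hp => And.intro hp.1.1.1 hp.1.2.1

variable [MeasurableSpace X] [BorelSpace X] {s : ℝ → X}

theorem IsIndexedChain.map_apply_diff (hI : IsValueInterval I) (hC : IsIndexedChain (G ∩ I) C)
    (hsm : Measurable s) (hs : ∀ t ∈ I, ∀ g ∈ (G : Set ℝ) ∩ I, s t ∈ C g ↔ t < g) {g h : ℝ}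
    (hg : g ∈ (G : Set ℝ) ∩ I) (hh : h ∈ (G : Set ℝ) ∩ I) :
    (volume.restrict I).map s (C h \ C g) = ENNReal.ofReal (h - g) := by
  have hm : MeasurableSet (C h \ C g) := (hC.isOpen h hh).measurableSet.diff
    (hC.isOpen g hg).measurableSet
  rw [Measure.map_apply hsm hm, Measure.restrict_apply (hsm hm), ← Real.volume_Ico]
  congr 1
  ext t
  refine ⟨fun ⟨ht, htI⟩ => ⟨not_lt.1 fun h' => ht.2 ((hs t htI g hg).2 h'),
    (hs t htI h hh).1 ht.1⟩, fun ht => ?_⟩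
  have htI : t ∈ I := hI.ordConnected.out hg.2 hh.2 ⟨ht.1, ht.2.le⟩
  exact ⟨⟨(hs t htI h hh).2 ht.2, fun h' => absurd ((hs t htI g hg).1 h') (not_lt.2 ht.1)⟩, htI⟩

theorem IsIndexedChain.map_apply (hI : IsValueInterval I) (hC : IsIndexedChain (G ∩ I) C)
    (hsm : Measurable s) (hs : ∀ t ∈ I, ∀ g ∈ (G : Set ℝ) ∩ I, s t ∈ C g ↔ t < g) {g : ℝ}
    (hg : g ∈ (G : Set ℝ) ∩ I) : (volume.restrict I).map s (C g) = ENNReal.ofReal g := by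
  simpa [hC.zero] using hC.map_apply_diff hI hsm hs ⟨G.zero_mem, hI.zero_mem⟩ hg

theorem IsIndexedChain.map_apply_lt_top (hI : IsValueInterval I) (hC : IsIndexedChain (G ∩ I) C)
    (hsm : Measurable s) (hs : ∀ t ∈ I, ∀ g ∈ (G : Set ℝ) ∩ I, s t ∈ C g ↔ t < g) {U : Set X}
    (hU : IsCompact U) : (volume.restrict I).map s U < ∞ := by
  obtain ⟨g, hg, hUg⟩ := hC.exists_subset ⟨G.zero_mem, hI.zero_mem⟩ hU
  exact (measure_mono hUg).trans_lt (by simp [hC.map_apply hI hsm hs hg])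

/-- Inclusion-exclusion inside the group `G`: two differences meet in another difference, with
endpoints given by `max` and `min`, so induction on the number of pieces applies. -/
theorem IsIndexedChain.measureReal_biUnion_mem (hI : IsValueInterval I)
    (hC : IsIndexedChain (G ∩ I) C) (hsm : Measurable s)
    (hs : ∀ t ∈ I, ∀ g ∈ (G : Set ℝ) ∩ I, s t ∈ C g ↔ t < g) {ι : Type*} (F : Finset ι)
    (g h : ι → ℝ) (hgh : ∀ i ∈ F, g i ∈ (G : Set ℝ) ∩ I ∧ h i ∈ (G : Set ℝ) ∩ I) :
    ((volume.restrict I).map s).real (⋃ i ∈ F, C (h i) \ C (g i)) ∈ G := by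
  classical
  have hmax : ∀ a b : ℝ, a ∈ (G : Set ℝ) ∩ I → b ∈ (G : Set ℝ) ∩ I →
      (max a b ∈ (G : Set ℝ) ∩ I ∧ C (max a b) = C a ∪ C b) ∧
      (min a b ∈ (G : Set ℝ) ∩ I ∧ C (min a b) = C a ∩ C b) := fun a b ha hb => by
    rcases le_total a b with h | h
    · have h' : C a ⊆ C b := hC.strictMonoOn.monotoneOn ha hb h
      simp only [h, max_eq_right, min_eq_left, ha, hb, union_eq_self_of_subset_left h',
        inter_eq_self_of_subset_left h', and_self]
    · have h' : C b ⊆ C a := hC.strictMonoOn.monotoneOn hb ha h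
      simp only [h, max_eq_left, min_eq_right, ha, hb, union_eq_self_of_subset_right h',
        inter_eq_self_of_subset_right h', and_self]
  induction F using Finset.induction_on generalizing g h with
  | empty => simp
  | insert j F hj ih =>
    have hj' := hgh j (Finset.mem_insert_self j F)
    have hF := fun i hi => hgh i (Finset.mem_insert_of_mem (b := j) hi : i ∈ insert j F)
    have hfin : ∀ i ∈ insert j F, (volume.restrict I).map s (C (h i) \ C (g i)) ≠ ∞ :=
      fun i hi => by simp [hC.map_apply_diff hI hsm hs (hgh i hi).1 (hgh i hi).2]
    have hm : ∀ i ∈ insert j F, MeasurableSet (C (h i) \ C (g i)) := fun i hi =>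
      (hC.isOpen _ (hgh i hi).2).measurableSet.diff (hC.isOpen _ (hgh i hi).1).measurableSet
    have hunion := measureReal_union_add_inter (μ := (volume.restrict I).map s)
      (s := C (h j) \ C (g j)) (t := ⋃ i ∈ F, C (h i) \ C (g i))
      (F.measurableSet_biUnion fun i hi => hm i (Finset.mem_insert_of_mem hi))
      (hfin j (Finset.mem_insert_self j F))
      ((measure_biUnion_lt_top F.finite_toSet fun i hi =>
        (hfin i (Finset.mem_insert_of_mem hi)).lt_top).ne)
    have hinter : (C (h j) \ C (g j)) ∩ ⋃ i ∈ F, C (h i) \ C (g i) =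
        ⋃ i ∈ F, C (min (h j) (h i)) \ C (max (g j) (g i)) := by
      rw [inter_iUnion₂]
      refine iUnion₂_congr fun i hi => ?_
      rw [(hmax _ _ hj'.1 (hF i hi).1).1.2, (hmax _ _ hj'.2 (hF i hi).2).2.2]
      ext x
      simp only [mem_inter_iff, mem_sdiff, mem_union]
      tauto
    have h1 := ih g h hF
    have h2 := ih (fun i => max (g j) (g i)) (fun i => min (h j) (h i)) fun i hi =>
      ⟨(hmax _ _ hj'.1 (hF i hi).1).1.1, (hmax _ _ hj'.2 (hF i hi).2).2.1⟩
    have h3 : ((volume.restrict I).map s).real (C (h j) \ C (g j)) ∈ G := by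
      rw [measureReal_def, hC.map_apply_diff hI hsm hs hj'.1 hj'.2]
      rcases le_total (g j) (h j) with hle | hle
      · rw [ENNReal.toReal_ofReal (sub_nonneg.2 hle)]
        exact G.sub_mem hj'.2.1 hj'.1.1
      · rw [ENNReal.ofReal_of_nonpos (sub_nonpos.2 hle)]
        exact G.zero_mem
    rw [hinter] at hunion
    rw [Finset.set_biUnion_insert, eq_sub_of_add_eq hunion]
    exact G.sub_mem (G.add_mem h3 h1) h2

theorem IsIndexedChain.measureReal_mem [T2Space X] (hI : IsValueInterval I)
    (hC : IsIndexedChain (G ∩ I) C) (hsm : Measurable s)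
    (hs : ∀ t ∈ I, ∀ g ∈ (G : Set ℝ) ∩ I, s t ∈ C g ↔ t < g) {U : Set X} (hUc : IsCompact U)
    (hUo : IsOpen U) : ((volume.restrict I).map s).real U ∈ (G : Set ℝ) ∩ I := by
  obtain ⟨c, hc, hUsub⟩ := hC.exists_subset ⟨G.zero_mem, hI.zero_mem⟩ hUc
  constructor
  · choose! g hg h hh hx hsub using hC.exists_mem_diff U hUo
    obtain ⟨F, hFU, hF⟩ := hUc.elim_nhds_subcover (fun x => C (h x) \ C (g x)) fun x hxU =>
      ((hC.isOpen _ (hh x hxU)).sdiff (hC.isCompact _ (hg x hxU)).isClosed).mem_nhds (hx x hxU)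
    have hU : U = ⋃ x ∈ F, C (h x) \ C (g x) :=
      hF.antisymm (iUnion₂_subset fun x hxF => hsub x (hFU x hxF))
    rw [hU]
    exact hC.measureReal_biUnion_mem hI hsm hs F g h fun x hxF =>
      ⟨hg x (hFU x hxF), hh x (hFU x hxF)⟩
  · refine hI.ordConnected.out hI.zero_mem hc.2 ⟨measureReal_nonneg, ?_⟩
    rw [measureReal_def]
    refine ENNReal.toReal_le_of_le_ofReal (hI.nonneg c hc.2) ?_
    rw [← hC.map_apply hI hsm hs hc]
    exact measure_mono hUsub

theorem continuous_measureReal_inter_Iio {A : Set ℝ} (hA : volume A ≠ ∞) :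
    Continuous fun t => volume.real (A ∩ Iio t) := by
  refine (LipschitzWith.of_le_add fun t u => ?_).continuous
  have hfin : ∀ v, volume (A ∩ Iio v) ≠ ∞ := fun v => measure_ne_top_of_subset inter_subset_left hA
  calc volume.real (A ∩ Iio t) ≤ volume.real (A ∩ Iio u ∪ Ico u t) :=
        measureReal_mono (fun x hx => (lt_or_ge x u).imp (fun h => ⟨hx.1, h⟩) fun h => ⟨h, hx.2⟩)
          (measure_union_ne_top (hfin u) measure_Ico_lt_top.ne)
    _ ≤ volume.real (A ∩ Iio u) + volume.real (Ico u t) := measureReal_union_le _ _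
    _ ≤ volume.real (A ∩ Iio u) + dist t u := by
        gcongr
        rw [Real.volume_real_Ico, Real.dist_eq]
        exact max_le (le_abs_self _) (abs_nonneg _)

/-- The intermediate value theorem gives a real cut `t` of the right measure. The local structure of
`V` at `s t` then shows that `t` lies in `G` or can be moved to a point of `G` at no cost. With `a`
the measure of a compact open set, this is goodness. -/
theorem IsIndexedChain.exists_measureReal_inter_eq [T2Space X] (hI : IsValueInterval I)
    (hC : IsIndexedChain (G ∩ I) C) (hsm : Measurable s)
    (hs : ∀ t ∈ I, ∀ g ∈ (G : Set ℝ) ∩ I, s t ∈ C g ↔ t < g) {V : Set X} (hVc : IsCompact V)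
    (hVo : IsOpen V) {a : ℝ} (haG : a ∈ G) (ha0 : 0 ≤ a)
    (ha : a ≤ ((volume.restrict I).map s).real V) :
    ∃ g ∈ (G : Set ℝ) ∩ I, ((volume.restrict I).map s).real (V ∩ C g) = a := by
  set μ := (volume.restrict I).map s with hμ
  have hreal : ∀ U, IsOpen U → μ.real U = volume.real (s ⁻¹' U ∩ I) := fun U hU => by
    rw [measureReal_def, measureReal_def, hμ, Measure.map_apply hsm hU.measurableSet,
      Measure.restrict_apply (hsm hU.measurableSet)]
  set A := s ⁻¹' V ∩ I with hA
  have hAfin : volume A ≠ ∞ := by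
    rw [hA, ← Measure.restrict_apply (hsm hVo.measurableSet),
      ← Measure.map_apply hsm hVo.measurableSet]
    exact (hC.map_apply_lt_top hI hsm hs hVc).ne
  have hAg : ∀ g ∈ (G : Set ℝ) ∩ I, volume.real (A ∩ Iio g) = μ.real (V ∩ C g) := fun g hg => by
    rw [hreal _ (hVo.inter (hC.isOpen g hg))]
    congr 1
    ext t
    constructor
    · rintro ⟨⟨h1, h2⟩, h3⟩
      exact ⟨⟨h1, (hs t h2 g hg).2 h3⟩, h2⟩
    · rintro ⟨⟨h1, h2⟩, h3⟩
      exact ⟨⟨h1, h3⟩, (hs t h3 g hg).1 h2⟩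
  have hAG : ∀ g ∈ (G : Set ℝ) ∩ I, volume.real (A ∩ Iio g) ∈ G := fun g hg => by
    rw [hAg g hg]
    exact (hC.measureReal_mem hI hsm hs (hVc.inter_right (hC.isCompact g hg).isClosed)
      (hVo.inter (hC.isOpen g hg))).1
  obtain ⟨c, hc, hVsub⟩ := hC.exists_subset ⟨G.zero_mem, hI.zero_mem⟩ hVc
  obtain ⟨t, ht, hFt⟩ := intermediate_value_Icc (hI.nonneg c hc.2)
    (continuous_measureReal_inter_Iio hAfin).continuousOn
    (show a ∈ Icc _ _ from ⟨by
      rw [show A ∩ Iio 0 = ∅ from eq_empty_of_forall_notMem fun x hx =>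
        absurd hx.2 (not_lt.2 (hI.nonneg x hx.1.2))]
      simpa using ha0, by
      rwa [hAg c hc, inter_eq_self_of_subset_left hVsub]⟩)
  have htI : t ∈ I := hI.ordConnected.out hI.zero_mem hc.2 ht
  dsimp only at hFt
  by_cases hxV : s t ∈ V
  · obtain ⟨g, hg, h, hh, hx, hsub⟩ := hC.exists_mem_diff V hVo _ hxV
    have hgt : g ≤ t := not_lt.1 fun h' => hx.2 ((hs t htI g hg).2 h')
    -- A basic neighbourhood of `s t` lies in `V`, so `A` contains `[g, t)`. Thus `t - g` is a
    -- difference of two elements of `G`.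
    have hsplit : A ∩ Iio t = A ∩ Iio g ∪ Ico g t := by
      ext u
      constructor
      · exact fun hu => (lt_or_ge u g).imp (fun h => ⟨hu.1, h⟩) fun h => ⟨h, hu.2⟩
      · rintro (hu | hu)
        · exact ⟨hu.1, lt_of_lt_of_le hu.2 hgt⟩
        · have huI : u ∈ I := hI.ordConnected.out hg.2 htI ⟨hu.1, hu.2.le⟩
          refine ⟨⟨hsub ⟨(hs u huI h hh).2 (hu.2.trans ((hs t htI h hh).1 hx.1)), fun h' => ?_⟩,
            huI⟩, hu.2⟩
          exact absurd ((hs u huI g hg).1 h') (not_lt.2 hu.1)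
    have hsum : volume.real (A ∩ Iio t) = volume.real (A ∩ Iio g) + (t - g) := by
      have hdisj : Disjoint (A ∩ Iio g) (Ico g t) :=
        disjoint_left.2 fun u hu hu' => absurd (mem_Iio.1 hu.2) (not_lt.2 hu'.1)
      rw [hsplit, measureReal_union hdisj measurableSet_Ico (measure_ne_top_of_subset inter_subset_left hAfin)
        measure_Ico_lt_top.ne, Real.volume_real_Ico_of_le hgt]
    have htG : t ∈ G := by
      have : t = g + (a - volume.real (A ∩ Iio g)) := by linarith
      rw [this]
      exact G.add_mem hg.1 (G.sub_mem haG (hAG g hg))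
    exact ⟨t, ⟨htG, htI⟩, by rw [← hAg t ⟨htG, htI⟩, hFt]⟩
  -- Here `A` misses `[g, t)`, so cutting at `g` gives the same measure.
  · obtain ⟨g, hg, h, hh, hx, hsub⟩ := hC.exists_mem_diff Vᶜ hVc.isClosed.isOpen_compl _ hxV
    have hgt : g ≤ t := not_lt.1 fun h' => hx.2 ((hs t htI g hg).2 h')
    refine ⟨g, hg, ?_⟩
    rw [← hAg g hg, ← hFt]
    congr 1
    ext u
    refine ⟨fun hu => ⟨hu.1, lt_of_lt_of_le hu.2 hgt⟩, fun hu => ⟨hu.1, ?_⟩⟩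
    by_contra hug
    have hug : g ≤ u := not_lt.1 hug
    refine hsub ⟨(hs u hu.1.2 h hh).2 (lt_trans hu.2 ((hs t htI h hh).1 hx.1)), fun h' => ?_⟩
      hu.1.1
    exact absurd ((hs u hu.1.2 g hg).1 h') (not_lt.2 hug)

theorem IsNoncompactCantor.exists_isGood [T2Space X] (hX : IsNoncompactCantor X) (hI : IsValueInterval I)
    (hG : Dense (G : Set ℝ)) (hGc : (G : Set ℝ).Countable) :
    ∃ μ : Measure X, IsFullNonatomic μ ∧ μ univ = volume I ∧ (∀ U, IsCompact U → μ U < ∞) ∧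
      IsGood μ ∧
      (∀ U, IsCompact U → IsOpen U → ∃ g ∈ (G : Set ℝ) ∩ I, μ U = ENNReal.ofReal g) ∧
      ∀ g ∈ (G : Set ℝ) ∩ I, ∃ U, IsCompact U ∧ IsOpen U ∧ μ U = ENNReal.ofReal g := by
  obtain ⟨C, hC⟩ := hX.exists_isIndexedChain hGc hG hI G.zero_mem
  obtain ⟨s, hsm, hs⟩ := hC.exists_measurable_section hI hG hGc
  have hfin : ∀ U, IsCompact U → (volume.restrict I).map s U < ∞ := fun U hU =>
    hC.map_apply_lt_top hI hsm hs hU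
  have hval : ∀ U, IsCompact U → (volume.restrict I).map s U =
      ENNReal.ofReal (((volume.restrict I).map s).real U) := fun U hU =>
    (ENNReal.ofReal_toReal (hfin U hU).ne).symm
  refine ⟨(volume.restrict I).map s, ⟨fun U hU hne => ?_, fun x => ?_⟩, ?_, hfin, ?_, ?_, ?_⟩
  · obtain ⟨x, hx⟩ := hne
    obtain ⟨g, hg, h, hh, hxgh, hsub⟩ := hC.exists_mem_diff U hU x hx
    refine lt_of_lt_of_le ?_ (measure_mono hsub)
    rw [hC.map_apply_diff hI hsm hs hg hh, ENNReal.ofReal_pos, sub_pos]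
    by_contra hhg
    exact hxgh.2 (hC.mem_of_le hh hg (not_lt.1 hhg) hxgh.1)
  · rw [Measure.map_apply hsm (measurableSet_singleton x),
      Measure.restrict_apply (hsm (measurableSet_singleton x))]
    -- Density of `G` makes `s` injective on `I`, so the fibre of a point is a Lebesgue null set.
    have hlt : ∀ t ∈ I, ∀ u ∈ I, t < u → s t ≠ s u := fun t ht u hu htu heq => by
      obtain ⟨g, hg, htg, hgu⟩ := hI.exists_between hG ht hu htu
      have := (hs t ht g hg).2 htg
      rw [heq, hs u hu g hg] at this
      exact absurd this (not_lt.2 hgu.le)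
    refine Subsingleton.measure_zero (fun t ht u hu => ?_) _
    have heq : s t = s u := ht.1.trans hu.1.symm
    rcases lt_trichotomy t u with h | h | h
    · exact absurd heq (hlt t ht.2 u hu.2 h)
    · exact h
    · exact absurd heq.symm (hlt u hu.2 t ht.2 h)
  · rw [Measure.map_apply hsm MeasurableSet.univ, preimage_univ, Measure.restrict_apply_univ]
  · intro V hVc hVo U hUc hUo hUV
    obtain ⟨g, hg, hgU⟩ := hC.exists_measureReal_inter_eq hI hsm hs hVc hVo
      (hC.measureReal_mem hI hsm hs hUc hUo).1 measureReal_nonneg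
      (ENNReal.toReal_mono (hfin V hVc).ne hUV.le)
    have hW : IsCompact (V ∩ C g) := hVc.inter_right (hC.isCompact g hg).isClosed
    exact ⟨V ∩ C g, hW, hVo.inter (hC.isOpen g hg), inter_subset_left, by
      rw [hval _ hW, hval _ hUc, hgU]⟩
  · exact fun U hUc hUo => ⟨_, hC.measureReal_mem hI hsm hs hUc hUo, hval U hUc⟩
  · exact fun g hg => ⟨C g, hC.isCompact g hg, hC.isOpen g hg, hC.map_apply hI hsm hs hg⟩

end ChainMeasure

/-! ### Divisibility of the value set as an invariant -/

section Invariant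

/-- The real numbers that have a denominator all of whose prime factors are `2` or in `T`. -/
def smoothFractions (T : Set ℕ) : AddSubgroup ℝ where
  carrier := {x | ∃ n : ℕ, n ≠ 0 ∧ (∀ p, p.Prime → p ∣ n → p = 2 ∨ p ∈ T) ∧
    ∃ k : ℤ, x * n = k}
  zero_mem' := ⟨1, one_ne_zero, fun p hp h => absurd h hp.not_dvd_one, 0, by simp⟩
  add_mem' := by
    rintro x y ⟨n, hn, hnT, k, hk⟩ ⟨m, hm, hmT, l, hl⟩
    refine ⟨n * m, mul_ne_zero hn hm, fun p hp h => ?_, k * m + l * n, ?_⟩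
    · exact (hp.dvd_mul.1 h).elim (hnT p hp) (hmT p hp)
    · push_cast
      rw [← hk, ← hl]
      ring
  neg_mem' := by
    rintro x ⟨n, hn, hnT, k, hk⟩
    exact ⟨n, hn, hnT, -k, by push_cast; rw [← hk]; ring⟩

theorem mem_smoothFractions {T : Set ℕ} {x : ℝ} : x ∈ smoothFractions T ↔
    ∃ n : ℕ, n ≠ 0 ∧ (∀ p, p.Prime → p ∣ n → p = 2 ∨ p ∈ T) ∧ ∃ k : ℤ, x * n = k :=
  Iff.rfl

theorem half_pow_mem_smoothFractions (T : Set ℕ) (n : ℕ) : (1 / 2 : ℝ) ^ n ∈ smoothFractions T :=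
  mem_smoothFractions.2 ⟨2 ^ n, pow_ne_zero n two_ne_zero, fun _ hp h =>
    Or.inl ((Nat.prime_dvd_prime_iff_eq hp Nat.prime_two).1 (hp.dvd_of_dvd_pow h)), 1, by
      push_cast
      rw [← mul_pow]
      simp⟩

/-- The prime `2` is always allowed in denominators so that the group contains arbitrarily small
powers of `1 / 2`, even for empty `T`. -/
theorem dense_smoothFractions (T : Set ℕ) : Dense (smoothFractions T : Set ℝ) := by
  refine (smoothFractions T).dense_of_not_isolated_zero fun ε hε => ?_
  obtain ⟨n, hn⟩ := exists_pow_lt_of_lt_one hε (by norm_num : (1 / 2 : ℝ) < 1)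
  exact ⟨_, half_pow_mem_smoothFractions T n, by positivity, hn⟩

theorem countable_smoothFractions (T : Set ℕ) : (smoothFractions T : Set ℝ).Countable := by
  refine (countable_range ((↑) : ℚ → ℝ)).mono ?_
  rintro x ⟨n, hn, -, k, hk⟩
  refine ⟨k / n, ?_⟩
  push_cast
  rw [← hk]
  field_simp

theorem div_mem_smoothFractions {T : Set ℕ} {p : ℕ} (hp : p.Prime) (hpT : p ∈ T) {x : ℝ}
    (hx : x ∈ smoothFractions T) : x / p ∈ smoothFractions T := by
  obtain ⟨n, hn, hnT, k, hk⟩ := mem_smoothFractions.1 hx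
  refine mem_smoothFractions.2 ⟨p * n, mul_ne_zero hp.ne_zero hn, fun q hq h => ?_, k, ?_⟩
  · rcases hq.dvd_mul.1 h with h | h
    · exact Or.inr ((Nat.prime_dvd_prime_iff_eq hq hp).1 h ▸ hpT)
    · exact hnT q hq h
  · have : (p : ℝ) ≠ 0 := Nat.cast_ne_zero.2 hp.ne_zero
    rw [← hk]
    push_cast
    field_simp

theorem mem_of_mul_eq_half {T : Set ℕ} {p : ℕ} (hp : p.Prime) (hp2 : p ≠ 2) {x : ℝ}
    (hx : x ∈ smoothFractions T) (h : p * x = 1 / 2) : p ∈ T := by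
  obtain ⟨n, hn, hnT, k, hk⟩ := mem_smoothFractions.1 hx
  refine (hnT p hp ?_).resolve_left hp2
  have : (n : ℝ) = p * (2 * k) := by
    rw [← hk]
    linear_combination (-2 * n : ℝ) * h
  exact Int.natCast_dvd_natCast.1 ⟨2 * k, by exact_mod_cast this⟩

variable {X Y : Type*} [TopologicalSpace X] [MeasurableSpace X] [TopologicalSpace Y]
  [MeasurableSpace Y]

/-- The natural numbers by which the set of values on compact open sets is divisible. -/
def divisorSet (μ : Measure X) : Set ℕ :=
  {p | ∀ U, IsCompact U → IsOpen U → ∃ W, IsCompact W ∧ IsOpen W ∧ (p : ℝ≥0∞) * μ W = μ U}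

/-- The scaling constant is positive and finite, so it cancels from both sides of the divisibility
equation. -/
theorem WeaklyHomeomorphic.divisorSet_subset [BorelSpace X] {μ : Measure X}
    {ν : Measure Y} (H : WeaklyHomeomorphic μ ν) : divisorSet μ ⊆ divisorSet ν := by
  obtain ⟨h, c, hc, hh⟩ := H
  intro p hp U hUc hUo
  obtain ⟨W, hWc, hWo, hW⟩ := hp (h ⁻¹' U) (h.isCompact_preimage.2 hUc) (hUo.preimage h.continuous)
  refine ⟨h '' W, hWc.image h.continuous, h.isOpenMap W hWo, ?_⟩
  rw [hh W hWo.measurableSet, hh _ (hUo.preimage h.continuous).measurableSet,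
    image_preimage_eq U h.surjective, mul_left_comm] at hW
  exact (ENNReal.mul_right_inj (by simpa using hc.ne') ENNReal.coe_ne_top).1 hW

theorem WeaklyHomeomorphic.divisorSet_eq [BorelSpace X] [BorelSpace Y] {μ : Measure X}
    {ν : Measure Y} (H : WeaklyHomeomorphic μ ν) : divisorSet μ = divisorSet ν :=
  H.divisorSet_subset.antisymm H.symm.divisorSet_subset

theorem Homeomorphic.weaklyHomeomorphic {μ : Measure X} {ν : Measure Y} (H : Homeomorphic μ ν) :
    WeaklyHomeomorphic μ ν := by
  obtain ⟨h, hh⟩ := H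
  exact ⟨h, 1, one_pos, fun E hE => by simpa using hh E hE⟩

theorem defectiveSet_eq_empty (hX : IsNoncompactCantor X) {μ : Measure X}
    (hμ : ∀ U, IsCompact U → μ U < ∞) : defectiveSet μ = ∅ := by
  obtain ⟨b, hb, hbco⟩ := hX.exists_seq_basis
  refine eq_empty_of_forall_notMem fun x hx => ?_
  obtain ⟨_, ⟨n, rfl⟩, hxn, -⟩ := hb.exists_subset_of_mem_open (mem_univ x) isOpen_univ
  exact (hμ _ (hbco n).1).ne (hx _ (hbco n).1 (hbco n).2 hxn)

theorem IsNoncompactCantor.exists_isGood_divisorSet [BorelSpace X] (hX : IsNoncompactCantor X)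
    {I : Set ℝ} (hI : IsValueInterval I) (hI2 : (1 / 2 : ℝ) ∈ I) (T : Set ℕ) :
    ∃ μ : Measure X, IsFullNonatomic μ ∧ μ univ = volume I ∧ μ (defectiveSet μ) = 0 ∧ IsGood μ ∧
      ∀ p : ℕ, p.Prime → p ≠ 2 → (p ∈ divisorSet μ ↔ p ∈ T) := by
  have := hX.metrizable
  obtain ⟨μ, hfull, huniv, hfin, hgood, hval, hsurj⟩ :=
    hX.exists_isGood hI (dense_smoothFractions T) (countable_smoothFractions T)
  refine ⟨μ, hfull, huniv, by simp [defectiveSet_eq_empty hX hfin], hgood,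
    fun p hp hp2 => ⟨fun h => ?_, fun h U hUc hUo => ?_⟩⟩
  -- The test value is `1 / 2` because `1` is not a value when `I = [0, 1)`; being a power of `1 /
  -- 2`, it imposes nothing on odd primes.
  · obtain ⟨U, hUc, hUo, hU⟩ := hsurj (1 / 2)
      ⟨by simpa using half_pow_mem_smoothFractions T 1, hI2⟩
    obtain ⟨W, hWc, hWo, hW⟩ := h U hUc hUo
    obtain ⟨g, hg, hWg⟩ := hval W hWc hWo
    refine mem_of_mul_eq_half hp hp2 hg.1 ?_
    have hg0 := hI.nonneg g hg.2
    rw [hU, hWg, ← ENNReal.ofReal_natCast, ← ENNReal.ofReal_mul (Nat.cast_nonneg p),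
      ENNReal.ofReal_eq_ofReal_iff (by positivity) (by norm_num)] at hW
    exact hW
  · obtain ⟨g, hg, hUg⟩ := hval U hUc hUo
    have hg0 := hI.nonneg g hg.2
    have hp1 : (1 : ℝ) ≤ p := Nat.one_le_cast.2 hp.one_le
    obtain ⟨W, hWc, hWo, hW⟩ := hsurj (g / p) ⟨div_mem_smoothFractions hp h hg.1,
      hI.ordConnected.out hI.zero_mem hg.2 ⟨by positivity, div_le_self hg0 hp1⟩⟩
    refine ⟨W, hWc, hWo, ?_⟩
    rw [hW, hUg, ← ENNReal.ofReal_natCast, ← ENNReal.ofReal_mul (Nat.cast_nonneg p),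
      mul_div_cancel₀ _ (by positivity)]

end Invariant

/-! ### Counting the classes -/

section Cardinality

theorem continuum_le_mk_of_odd_primes {α : Type*}
    (f : Set {p : ℕ // p.Prime ∧ p ≠ 2} → α) (hf : Function.Injective f) : 𝔠 ≤ #α := by
  have : Infinite {p : ℕ // p.Prime ∧ p ≠ 2} := by
    have h : ({p : ℕ | p.Prime} \ {2}).Infinite :=
      Nat.infinite_setOfPred_prime.sdiff (finite_singleton 2)
    exact h.to_subtype
  have h := Cardinal.lift_mk_le_lift_mk_of_injective hf
  rw [Cardinal.mk_set, Cardinal.mk_eq_aleph0, Cardinal.two_power_aleph0,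
    Cardinal.lift_continuum, Cardinal.lift_uzero] at h
  exact h

theorem mk_ennreal_le_continuum : #ℝ≥0∞ ≤ 𝔠 := by
  have h : #ℝ≥0 ≤ 𝔠 := Cardinal.mk_real ▸ Cardinal.mk_subtype_le _
  calc #ℝ≥0∞ = #(Option ℝ≥0) := rfl
    _ = #ℝ≥0 + 1 := Cardinal.mk_option
    _ ≤ 𝔠 + 𝔠 := add_le_add h (Cardinal.one_le_aleph0.trans Cardinal.aleph0_le_continuum)
    _ = 𝔠 := Cardinal.continuum_add_self

variable {X : Type*} [TopologicalSpace X]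

theorem mk_compactOpen_fun_le_continuum (hX : IsNoncompactCantor X) :
    #({U : Set X | IsCompact U ∧ IsOpen U} → ℝ≥0∞) ≤ 𝔠 := by
  obtain ⟨b, hb, -⟩ := hX.exists_seq_basis
  rw [Cardinal.mk_arrow]
  calc Cardinal.lift #ℝ≥0∞ ^ Cardinal.lift #{U : Set X | IsCompact U ∧ IsOpen U}
      ≤ 𝔠 ^ Cardinal.aleph0 := by
        refine (Cardinal.power_le_power_right ?_).trans
          (Cardinal.power_le_power_left Cardinal.continuum_ne_zero ?_)
        · exact Cardinal.lift_le_continuum.2 mk_ennreal_le_continuum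
        · exact Cardinal.lift_le_aleph0.2
            (countable_compactOpen hb (countable_range b)).le_aleph0
    _ = 𝔠 := Cardinal.continuum_power_aleph0

variable [MeasurableSpace X] [BorelSpace X]

/-- The defective set depends only on the values on compact open sets. Its complement carries both
measures and is a countable union of compact open sets of finite measure; on each of these the
π-system of compact open sets determines the measure. -/
theorem ext_of_compactOpen (hX : IsNoncompactCantor X) {μ ν : Measure X}
    (hμ : μ (defectiveSet μ) = 0) (hν : ν (defectiveSet ν) = 0)
    (h : ∀ U, IsCompact U → IsOpen U → μ U = ν U) : μ = ν := by
  have := hX.metrizable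
  obtain ⟨b, hb, hbco⟩ := hX.exists_seq_basis
  have := hb.secondCountableTopology (countable_range b)
  have hcount := countable_compactOpen hb (countable_range b)
  have hdef : defectiveSet ν = defectiveSet μ := by
    ext x
    exact forall_congr' fun U => forall₂_congr fun hUc hUo => by rw [h U hUc hUo]
  rw [hdef] at hν
  have hbasis : IsTopologicalBasis {U : Set X | IsCompact U ∧ IsOpen U} :=
    hb.of_isOpen_of_subset (fun U hU => hU.2) (by rintro _ ⟨n, rfl⟩; exact hbco n)
  have hcompl : (defectiveSet μ)ᶜ = ⋃ U ∈ {U : Set X | (IsCompact U ∧ IsOpen U) ∧ μ U ≠ ∞}, U := by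
    ext x
    simp only [defectiveSet, mem_compl_iff, mem_ofPred_eq, mem_iUnion₂]
    push Not
    exact ⟨fun ⟨U, hUc, hUo, hx, hU⟩ => ⟨U, ⟨⟨hUc, hUo⟩, hU⟩, hx⟩,
      fun ⟨U, ⟨⟨hUc, hUo⟩, hU⟩, hx⟩ => ⟨U, hUc, hUo, hx, hU⟩⟩
  rw [← Measure.restrict_eq_self_of_ae_mem (s := (defectiveSet μ)ᶜ) (compl_mem_ae_iff.2 hμ),
    ← Measure.restrict_eq_self_of_ae_mem (s := (defectiveSet μ)ᶜ) (compl_mem_ae_iff.2 hν), hcompl,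
    Measure.restrict_biUnion_congr (hcount.mono fun U hU => hU.1)]
  rintro U ⟨⟨hUc, hUo⟩, hU⟩
  have : IsFiniteMeasure (μ.restrict U) := ⟨by simpa using hU.lt_top⟩
  refine ext_of_generate_finite _
    ((BorelSpace.measurable_eq (α := X)).trans hbasis.borel_eq_generateFrom)
    (fun V hV W hW _ => ⟨hV.1.inter hW.1, hV.2.inter hW.2⟩) (fun V hV => ?_) ?_
  · rw [Measure.restrict_apply hV.2.measurableSet, Measure.restrict_apply hV.2.measurableSet]
    exact h _ (hV.1.inter hUc) (hV.2.inter hUo)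
  · simpa using h U hUc hUo

theorem mk_quotient_le_continuum (hX : IsNoncompactCantor X) {P : Measure X → Prop}
    (hP : ∀ μ, P μ → μ (defectiveSet μ) = 0) (r : Setoid {μ // P μ}) : #(Quotient r) ≤ 𝔠 := by
  refine Cardinal.mk_quotient_le.trans
    ((Cardinal.mk_le_of_injective (f := fun (μ : {μ // P μ})
      (U : {U : Set X | IsCompact U ∧ IsOpen U}) => μ.1 U) fun μ ν hμν => ?_).trans
      (mk_compactOpen_fun_le_continuum hX))
  exact Subtype.ext (ext_of_compactOpen hX (hP _ μ.2) (hP _ ν.2)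
    fun U hUc hUo => congrFun hμν ⟨U, hUc, hUo⟩)

/-- Equivalent measures have the same divisor set, and its odd primes give back `T`, so distinct
sets of odd primes give distinct classes. -/
theorem continuum_le_mk_quotient {P : Measure X → Prop}
    (hP : ∀ T : Set ℕ, ∃ μ, P μ ∧ ∀ p : ℕ, p.Prime → p ≠ 2 → (p ∈ divisorSet μ ↔ p ∈ T))
    (r : Setoid {μ // P μ}) (hr : ∀ μ ν, r μ ν → WeaklyHomeomorphic μ.1 ν.1) :
    𝔠 ≤ #(Quotient r) := by
  choose μ hμ hdiv using hP
  refine continuum_le_mk_of_odd_primes (fun T => Quotient.mk r ⟨μ ((↑) '' T), hμ _⟩) ?_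
  intro T S hTS
  have h := (hr _ _ (Quotient.exact hTS)).divisorSet_eq
  ext p
  have h1 := hdiv ((↑) '' T) p p.2.1 p.2.2
  rw [show divisorSet (μ ((↑) '' T)) = divisorSet (μ ((↑) '' S)) from h,
    hdiv ((↑) '' S) p p.2.1 p.2.2] at h1
  simpa only [Subtype.val_injective.mem_set_image] using h1.symm

end Cardinality

end LocallyCompactCantor

open LocallyCompactCantor in
theorem theorem2p12 {X : Type*} [TopologicalSpace X] [MeasurableSpace X] [BorelSpace X]
    (hX : LocallyCompactCantor.IsNoncompactCantor X) :
    #(Quotient (LocallyCompactCantor.homeomorphicSetoid X)) = 𝔠 ∧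
      #(Quotient (LocallyCompactCantor.weaklyHomeomorphicSetoid X)) = 𝔠 := by
  refine ⟨le_antisymm (mk_quotient_le_continuum hX ?_ _)
      (continuum_le_mk_quotient (fun T => ?_) _ fun μ ν h => Homeomorphic.weaklyHomeomorphic h),
    le_antisymm (mk_quotient_le_continuum hX (fun μ h => h.2.2.1) _)
      (continuum_le_mk_quotient (fun T => ?_) _ fun μ ν h => h)⟩
  · rintro μ ⟨-, hμ, -⟩
    rw [defectiveSet_eq_empty hX fun U _ =>
      ((MeasureTheory.measure_mono (Set.subset_univ U)).trans_eq hμ).trans_lt ENNReal.one_lt_top]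
    exact MeasureTheory.measure_empty
  · obtain ⟨μ, hfull, huniv, -, hgood, hdiv⟩ :=
      hX.exists_isGood_divisorSet isValueInterval_Ico (by norm_num) T
    exact ⟨μ, ⟨hfull, by simp [huniv], hgood⟩, hdiv⟩
  · obtain ⟨μ, hfull, huniv, hdef, hgood, hdiv⟩ :=
      hX.exists_isGood_divisorSet isValueInterval_Ici (by norm_num) T
    exact ⟨μ, ⟨hfull, by simp [huniv], hdef, hgood⟩, hdiv⟩
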